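/- \textbf{Proposition (IDS of the $(3^6)$ triangular tiling).} Let $\omega_1=(1,0)$, $\omega_2=(\cos(\pi/3),\sin(\pi/3))$, and let $G$ be the graph of the $(3^6)$ tiling of the plane by equilateral triangles of side length $1$: its vertex set is $\mathcal V=\mathbb Z\omega_1+\mathbb Z\omega_2\subset\mathbb R^2$, and two vertices are adjacent, $v\sim w$, iff their Euclidean distance is $1$. Let $\Delta$ be the Laplacian on $\ell^2(\mathcal V)$, $$(\Delta f)(v)=f(v)-\frac1{|v|}\sum_{w\sim v}f(w),$$ where $|v|$ ($=6$) is the degree of $v$. Let $Q\subset\mathcal V$ be a finite fundamental domain for the action of $\mathbb Z^2$ on $\mathcal V$ in which $(\gamma_1,\gamma_2)$ acts as translation by $\gamma_1\omega_1+\gamma_2\omega_2$ (so $Q$ consists of a single vertex), and for $E\in\mathbb R$ let $$N_{(3^6)}(E)=\frac1{|Q|}\operatorname{Tr}\bigl(\chi_Q\,\chi_{(-\infty,E]}(\Delta)\bigr)$$ be the integrated density of states, where $\chi_{(-\infty,E]}(\Delta)$ is the spectral projector of the bounded self-adjoint operator $\Delta$. Put $$\Diamond=\{(u,v)\in\mathbb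 R^2: |u|+|v|<\pi\sqrt2\},\qquad F(u,v)=2\cos\tfrac{u}{\sqrt2}\cos\tfrac{v}{\sqrt2}+2\cos^2\tfrac{u}{\sqrt2}-1 .$$ Then for all $E\in\mathbb R$ $$N_{(3^6)}(E)=\frac1{(2\pi)^2}\operatorname{Vol}\{(u,v)\in\Diamond: F(u,v)\ge 3-3E\}$$ $$=\begin{cases} 0 & \text{if } E<0,\\[2pt] \dfrac2{\pi^2}\displaystyle\int_{-\frac12+\frac12\sqrt{9-6E}}^{1}\frac{\arccos\left(\frac{4-3E}{2t}-t\right)}{\sqrt{1-t^2}}\,dt & \text{if } 0\le E<\frac43,\\[8pt] 1-\dfrac2{\pi^2}\displaystyle\int_{-\frac12-\frac12\sqrt{9-6E}}^{-\frac12+\frac12\sqrt{9-6E}}\frac{\arccos\left(\frac{4-3E}{2t}-t\right)}{\sqrt{1-t^2}}\,dt & \text{if } \frac43\le E<\frac32,\\[8pt] 1 & \text{if } E\ge\frac32 , \end{cases}$$ where the integrands are Lebesgue integrable on the indicated intervals. In particular, $N_{(3^6)}$ is continuous on $\mathbb R$, and $\Delta$ has no eigenfunctions in $\ell^2(\mathcal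 V)$. -/

import Mathlib

open scoped BigOperators

noncomputable section

/-! ## The Laplacian of a graph with bounded degrees on `ℓ²` of its vertices -/

/-- The Hilbert space `ℓ²(V)` of square summable complex functions on `V`. -/
abbrev EllTwo (V : Type*) := lp (fun _ : V => ℂ) 2

/-- The vertex degrees of `G` are uniformly bounded. -/
def HasBoundedDegree {V : Type*} (G : SimpleGraph V) [G.LocallyFinite] : Prop :=
  ∃ D : ℕ, ∀ v, G.degree v ≤ D

/-- The average `|v|⁻¹ ∑_{w ∼ v} f w` of a function over the neighbours of `v`. -/
def neighborAverage {V : Type*} (G : SimpleGraph V) [G.LocallyFinite] (f : V → ℂ) (v : V) : ℂ :=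
  (1 / (G.degree v : ℂ)) * ∑ w ∈ G.neighborFinset v, f w

theorem norm_sq_neighborAverage_le {V : Type*} (G : SimpleGraph V) [G.LocallyFinite]
    (f : V → ℂ) (v : V) :
    ‖neighborAverage G f v‖ ^ 2 ≤ ∑ w ∈ G.neighborFinset v, ‖f w‖ ^ 2 := by
  have hS : 0 ≤ ∑ w ∈ G.neighborFinset v, ‖f w‖ ^ 2 := Finset.sum_nonneg fun _ _ => sq_nonneg _
  rcases Nat.eq_zero_or_pos (G.degree v) with h | h
  · simpa [neighborAverage, h] using hS
  · have hd : (1 : ℝ) ≤ (G.degree v : ℝ) := by exact_mod_cast h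
    have h1 : ‖∑ w ∈ G.neighborFinset v, f w‖ ^ 2
        ≤ (G.degree v : ℝ) * ∑ w ∈ G.neighborFinset v, ‖f w‖ ^ 2 := by
      calc ‖∑ w ∈ G.neighborFinset v, f w‖ ^ 2
          ≤ (∑ w ∈ G.neighborFinset v, ‖f w‖) ^ 2 := by
            gcongr
            exact norm_sum_le _ _
        _ ≤ _ := by
            have := sq_sum_le_card_mul_sum_sq (s := G.neighborFinset v) (f := fun w => ‖f w‖)
            simpa using this
    have h2 : ‖neighborAverage G f v‖ ^ 2
        = ((G.degree v : ℝ) ^ 2)⁻¹ * ‖∑ w ∈ G.neighborFinset v, f w‖ ^ 2 := by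
      simp [neighborAverage, mul_pow]
    rw [h2, inv_mul_le_iff₀ (by positivity)]
    refine h1.trans ?_
    gcongr
    nlinarith

theorem sum_norm_sq_neighborAverage_le {V : Type*} (G : SimpleGraph V) [G.LocallyFinite]
    {D : ℕ} (hD : ∀ v, G.degree v ≤ D) (f : EllTwo V) (s : Finset V) :
    ∑ v ∈ s, ‖neighborAverage G f v‖ ^ 2 ≤ (D : ℝ) * ‖f‖ ^ 2 := by
  classical
  calc ∑ v ∈ s, ‖neighborAverage G f v‖ ^ 2
      ≤ ∑ v ∈ s, ∑ w ∈ G.neighborFinset v, ‖f w‖ ^ 2 :=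
        Finset.sum_le_sum fun v _ => norm_sq_neighborAverage_le G f v
    _ = ∑ w ∈ s.biUnion fun v => G.neighborFinset v,
          ∑ v ∈ s with w ∈ G.neighborFinset v, ‖f w‖ ^ 2 := by
        apply Finset.sum_comm'
        intro v w
        simp only [Finset.mem_biUnion, Finset.mem_filter]
        exact ⟨fun h => ⟨h, v, h⟩, fun h => h.1⟩
    _ ≤ ∑ w ∈ s.biUnion fun v => G.neighborFinset v, (D : ℝ) * ‖f w‖ ^ 2 := by
        apply Finset.sum_le_sum
        intro w _
        rw [Finset.sum_const, nsmul_eq_mul]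
        have hc : (s.filter fun v => w ∈ G.neighborFinset v).card ≤ D := by
          refine le_trans (Finset.card_le_card ?_) (hD w)
          intro v hv
          simp only [Finset.mem_filter, SimpleGraph.mem_neighborFinset] at hv ⊢
          exact hv.2.symm
        gcongr
    _ ≤ (D : ℝ) * ‖f‖ ^ 2 := by
        rw [← Finset.mul_sum]
        have := lp.sum_rpow_le_norm_rpow (p := 2) (by norm_num) f
          (s.biUnion fun v => G.neighborFinset v)
        simp only [ENNReal.toReal_ofNat, Real.rpow_ofNat] at this
        gcongr

theorem memℓp_neighborAverage {V : Type*} (G : SimpleGraph V) [G.LocallyFinite]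
    (hG : HasBoundedDegree G) (f : EllTwo V) : Memℓp (neighborAverage G f) 2 := by
  obtain ⟨D, hD⟩ := hG
  refine memℓp_gen' (C := (D : ℝ) * ‖f‖ ^ 2) fun s => ?_
  simpa using sum_norm_sq_neighborAverage_le G hD f s

/-- The averaging operator `f ↦ (v ↦ |v|⁻¹ ∑_{w ∼ v} f w)` on `ℓ²(V)`. -/
def averagingOperator {V : Type*} (G : SimpleGraph V) [G.LocallyFinite]
    (hG : HasBoundedDegree G) : EllTwo V →L[ℂ] EllTwo V :=
  LinearMap.mkContinuousOfExistsBound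
    { toFun := fun f => ⟨neighborAverage G f, memℓp_neighborAverage G hG f⟩
      map_add' := fun f g => by
        ext v
        simp only [neighborAverage, lp.coeFn_add, Pi.add_apply, Finset.sum_add_distrib, mul_add]
      map_smul' := fun c f => by
        ext v
        simp only [neighborAverage, lp.coeFn_smul, Pi.smul_apply, smul_eq_mul, RingHom.id_apply,
          ← Finset.mul_sum]
        ring }
    (by
      obtain ⟨D, hD⟩ := hG
      refine ⟨Real.sqrt D, fun f => ?_⟩
      refine lp.norm_le_of_forall_sum_le (p := 2) (by norm_num) (by positivity) fun s => ?_
      have := sum_norm_sq_neighborAverage_le G hD f s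
      simpa [mul_pow] using this)

/-- The graph Laplacian `(Δ f)(v) = f v - |v|⁻¹ ∑_{w ∼ v} f w` on `ℓ²(V)`. -/
def graphLaplacian {V : Type*} (G : SimpleGraph V) [G.LocallyFinite]
    (hG : HasBoundedDegree G) : EllTwo V →L[ℂ] EllTwo V :=
  1 - averagingOperator G hG

theorem graphLaplacian_apply {V : Type*} (G : SimpleGraph V) [G.LocallyFinite]
    (hG : HasBoundedDegree G) (f : EllTwo V) (v : V) :
    graphLaplacian G hG f v
      = f v - (1 / (G.degree v : ℂ)) * ∑ w ∈ G.neighborFinset v, f w := rfl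

/-- On a regular graph the Laplacian is self-adjoint. -/
theorem isSelfAdjoint_graphLaplacian {V : Type*} (G : SimpleGraph V) [G.LocallyFinite]
    (hG : HasBoundedDegree G) {d : ℕ} (hd : G.IsRegularOfDegree d) :
    IsSelfAdjoint (graphLaplacian G hG) := by
  classical
  refine (IsSelfAdjoint.one _).sub ?_
  rw [ContinuousLinearMap.isSelfAdjoint_iff']
  ext f v
  have h1 : ∀ g : EllTwo V, g v = inner ℂ (lp.single 2 v (1 : ℂ) : EllTwo V) g := fun g => by
    simp [lp.inner_single_left]
  have h2 : averagingOperator G hG (lp.single 2 v (1 : ℂ))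
      = ∑ w ∈ G.neighborFinset v, (1 / (d : ℂ)) • (lp.single 2 w (1 : ℂ) : EllTwo V) := by
    ext u
    change neighborAverage G _ u = _
    simp only [neighborAverage, hd u, lp.coeFn_single, lp.coeFn_sum, lp.coeFn_smul,
      Finset.sum_apply, Pi.smul_apply, smul_eq_mul, ← Finset.mul_sum]
    congr 1
    simp [Pi.single_apply, SimpleGraph.adj_comm]
  rw [h1, ContinuousLinearMap.adjoint_inner_right, h2, sum_inner]
  change _ = neighborAverage G f v
  simp [neighborAverage, inner_smul_left, lp.inner_single_left, hd v, Finset.mul_sum]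

/-! ## Spectral projectors, traces and the integrated density of states -/

/-- The spectral projector `χ_{(-∞, E]}(T)` of a bounded self-adjoint operator `T`.
As `χ_{(-∞, E]}` is the indicator function of the zero set of the continuous function
`x ↦ max (x - E) 0`, it is the orthogonal projection onto the kernel of the positive part
`(T - E)⁺`, which is given by the continuous functional calculus. -/
def spectralProjector {H : Type*} [NormedAddCommGroup H] [InnerProductSpace ℂ H] [CompleteSpace H]
    (T : H →L[ℂ] H) (E : ℝ) : H →L[ℂ] H :=
  (cfc (fun x : ℝ => max (x - E) 0) T).ker.starProjection

/-- The operator `χ_Q` of multiplication by the indicator function of `Q` on `ℓ²(V)`. -/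
def indicatorOperator {V : Type*} (Q : Set V) : EllTwo V →L[ℂ] EllTwo V :=
  LinearMap.mkContinuous
    { toFun := fun f => ⟨Q.indicator f, (lp.memℓp f).mono' fun v => by
        classical
        rw [Set.indicator_apply]
        split_ifs <;> simp⟩
      map_add' := fun f g => by
        ext v
        exact congrFun (Set.indicator_add' Q f g) v
      map_smul' := fun c f => by
        ext v
        exact congrFun (Set.indicator_const_smul Q c f) v }
    1 (fun f => by
      rw [one_mul]
      refine lp.norm_mono (by norm_num) fun v => ?_
      exact norm_indicator_le_norm_self _ v)

/-- The trace of an operator on `ℓ²(V)`, computed in the orthonormal basis `(δ_v)_{v ∈ V}`. -/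
def ellTwoTrace {V : Type*} [DecidableEq V] (A : EllTwo V →L[ℂ] EllTwo V) : ℂ :=
  ∑' v : V, inner ℂ (lp.single 2 v (1 : ℂ) : EllTwo V) (A (lp.single 2 v (1 : ℂ)))

/-- The integrated density of states
`N_G(E) = |Q|⁻¹ Tr (χ_Q χ_{(-∞, E]}(Δ))` of the Laplacian on `G`. -/
def integratedDensityOfStates {V : Type*} [DecidableEq V] (G : SimpleGraph V) [G.LocallyFinite]
    (hG : HasBoundedDegree G) (Q : Finset V) (E : ℝ) : ℝ :=
  (1 / (Q.card : ℝ)) *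
    (ellTwoTrace (indicatorOperator (Q : Set V) ∘L
      spectralProjector (graphLaplacian G hG) E)).re

/-- `Q` is a fundamental domain of the (free) action `T` of `Γ` on the vertices: every vertex is
`T γ q` for exactly one `γ ∈ Γ` and one `q ∈ Q`. -/
def IsVertexFundamentalDomain {Γ V : Type*} (T : Γ → V → V) (Q : Finset V) : Prop :=
  ∀ v, ∃! p : Γ × V, p.2 ∈ Q ∧ T p.1 p.2 = v

/-! ## The triangular lattice -/

/-- The translation vector `ω₁ = (1, 0)`. -/
def triOmega₁ : EuclideanSpace ℝ (Fin 2) := !₂[1, 0]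

/-- The translation vector `ω₂ = (cos (π / 3), sin (π / 3))`. -/
def triOmega₂ : EuclideanSpace ℝ (Fin 2) := !₂[Real.cos (Real.pi / 3), Real.sin (Real.pi / 3)]

/-- The point `m ω₁ + n ω₂` of the plane. The vertices of the `(3⁶)` tiling are these points,
and we index them by `(m, n) ∈ ℤ²`. -/
def triPoint (v : ℤ × ℤ) : EuclideanSpace ℝ (Fin 2) :=
  (v.1 : ℝ) • triOmega₁ + (v.2 : ℝ) • triOmega₂

/-- The graph of the `(3⁶)` tiling by equilateral triangles of side length one: vertices are joined
by an edge (a side of a triangle) iff their Euclidean distance is one. -/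
def triGraph : SimpleGraph (ℤ × ℤ) where
  Adj v w := dist (triPoint v) (triPoint w) = 1
  symm := ⟨fun v w h => by rw [dist_comm]; exact h⟩
  loopless := ⟨fun v h => by simp at h⟩

/-- The translation action of `ℤ²`: `(γ₁, γ₂)` moves a vertex by `γ₁ ω₁ + γ₂ ω₂`. -/
def triTranslate (γ v : ℤ × ℤ) : ℤ × ℤ := γ + v

theorem triPoint_triTranslate (γ v : ℤ × ℤ) :
    triPoint (triTranslate γ v)
      = ((γ.1 : ℝ) • triOmega₁ + (γ.2 : ℝ) • triOmega₂) + triPoint v := by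
  simp only [triPoint, triTranslate, Prod.fst_add, Prod.snd_add, Int.cast_add, add_smul]
  abel

theorem triGraph_adj_translate (γ v w : ℤ × ℤ) :
    triGraph.Adj (triTranslate γ v) (triTranslate γ w) ↔ triGraph.Adj v w := by
  simp only [triGraph, triPoint_triTranslate, dist_add_left]

theorem isVertexFundamentalDomain_singleton (a : ℤ × ℤ) :
    IsVertexFundamentalDomain triTranslate {a} := by
  intro v
  refine ⟨(v - a, a), by simp [triTranslate], ?_⟩
  rintro ⟨γ, q⟩ ⟨hq, h⟩
  simp only [Finset.mem_singleton] at hq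
  subst hq
  simp [← h, triTranslate]

theorem dist_triPoint_sq (v w : ℤ × ℤ) :
    dist (triPoint v) (triPoint w) ^ 2
      = (((v.1 - w.1) ^ 2 + (v.1 - w.1) * (v.2 - w.2) + (v.2 - w.2) ^ 2 : ℤ) : ℝ) := by
  have h3 : Real.sqrt 3 ^ 2 = 3 := Real.sq_sqrt (by norm_num)
  rw [EuclideanSpace.dist_sq_eq]
  simp only [Fin.sum_univ_two, Real.dist_eq, sq_abs]
  simp [triPoint, triOmega₁, triOmega₂]
  linear_combination ((v.2 : ℝ) - w.2) ^ 2 / 4 * h3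

/-- The six neighbours of a vertex of the triangular lattice. -/
def triNeighbors (v : ℤ × ℤ) : Finset (ℤ × ℤ) :=
  {v + (1, 0), v + (-1, 0), v + (0, 1), v + (0, -1), v + (-1, 1), v + (1, -1)}

theorem triGraph_adj_iff (v w : ℤ × ℤ) : triGraph.Adj v w ↔ w ∈ triNeighbors v := by
  have h1 : triGraph.Adj v w ↔
      (v.1 - w.1) ^ 2 + (v.1 - w.1) * (v.2 - w.2) + (v.2 - w.2) ^ 2 = 1 := by
    change dist (triPoint v) (triPoint w) = 1 ↔ _
    rw [← pow_left_inj₀ dist_nonneg zero_le_one two_ne_zero, dist_triPoint_sq, one_pow]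
    exact_mod_cast Iff.rfl
  rw [h1]
  obtain ⟨a, b⟩ := v
  obtain ⟨c, d⟩ := w
  simp only [triNeighbors, Finset.mem_insert, Finset.mem_singleton, Prod.mk_add_mk, Prod.mk.injEq]
  constructor
  · intro h
    obtain ⟨x, rfl⟩ : ∃ x, c = a + x := ⟨c - a, by ring⟩
    obtain ⟨y, rfl⟩ : ∃ y, d = b + y := ⟨d - b, by ring⟩
    ring_nf at h
    have hx1 : x ≤ 1 := by nlinarith [sq_nonneg (x + 2 * y)]
    have hx2 : -1 ≤ x := by nlinarith [sq_nonneg (x + 2 * y)]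
    have hy1 : y ≤ 1 := by nlinarith [sq_nonneg (2 * x + y)]
    have hy2 : -1 ≤ y := by nlinarith [sq_nonneg (2 * x + y)]
    interval_cases x <;> interval_cases y <;> simp_all
  · rintro (⟨rfl, rfl⟩ | ⟨rfl, rfl⟩ | ⟨rfl, rfl⟩ | ⟨rfl, rfl⟩ | ⟨rfl, rfl⟩ | ⟨rfl, rfl⟩) <;> ring

instance triGraphLocallyFinite : triGraph.LocallyFinite := fun v =>
  Fintype.ofFinset (triNeighbors v) fun w => by
    rw [SimpleGraph.mem_neighborSet, triGraph_adj_iff]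

theorem triGraph_neighborFinset (v : ℤ × ℤ) : triGraph.neighborFinset v = triNeighbors v := by
  ext w
  rw [SimpleGraph.mem_neighborFinset, triGraph_adj_iff]

theorem triGraph_degree (v : ℤ × ℤ) : triGraph.degree v = 6 := by
  rw [← SimpleGraph.card_neighborFinset_eq_degree, triGraph_neighborFinset]
  obtain ⟨a, b⟩ := v
  simp [triNeighbors, Finset.card_insert_of_notMem]

theorem triGraph_hasBoundedDegree : HasBoundedDegree triGraph :=
  ⟨6, fun v => (triGraph_degree v).le⟩

/-- The Laplacian of the `(3⁶)` tiling on `ℓ²` of its vertices. -/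
abbrev triLaplacian : EllTwo (ℤ × ℤ) →L[ℂ] EllTwo (ℤ × ℤ) :=
  graphLaplacian triGraph triGraph_hasBoundedDegree

theorem isSelfAdjoint_triLaplacian : IsSelfAdjoint triLaplacian :=
  isSelfAdjoint_graphLaplacian triGraph triGraph_hasBoundedDegree triGraph_degree

/-- The integrated density of states `N_{(3⁶)}` of the `(3⁶)` tiling, computed with the fundamental
domain `Q`. -/
abbrev triIDS (Q : Finset (ℤ × ℤ)) (E : ℝ) : ℝ :=
  integratedDensityOfStates triGraph triGraph_hasBoundedDegree Q E

/-! ## The explicit functions -/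

/-- The open diamond `{(u, v) : |u| + |v| < π √2}`. -/
def triDiamond : Set (ℝ × ℝ) := {p | |p.1| + |p.2| < Real.pi * Real.sqrt 2}

/-- `F(u, v) = 2 cos (u / √2) cos (v / √2) + 2 cos² (u / √2) - 1`. -/
def triF (p : ℝ × ℝ) : ℝ :=
  2 * Real.cos (p.1 / Real.sqrt 2) * Real.cos (p.2 / Real.sqrt 2)
    + 2 * Real.cos (p.1 / Real.sqrt 2) ^ 2 - 1

/-- The integrand `arccos ((4 - 3 E) / (2 t) - t) / √(1 - t²)`. -/
def triIntegrand (E t : ℝ) : ℝ :=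
  Real.arccos ((4 - 3 * E) / (2 * t) - t) / Real.sqrt (1 - t ^ 2)

end

/-! Fourier series on the torus diagonalise the translation-invariant Laplacian: `torusBasis`
carries characters to the basis vectors `δ_v`, and `triLaplacian` becomes multiplication by the real
trigonometric polynomial `triSymbol` (`triLaplacian_eq_mulRep`). The spectral projector then becomes
multiplication by the indicator of `{triSymbol ≤ E}`. Since characters have modulus one, its
diagonal entries equal the Haar measure of that set, so the IDS is the distribution function of the
symbol (`triIDS_eq_torusMeasure`). The level sets of the symbol are null, which gives both
continuity of the IDS and absence of eigenvalues.

A linear change of variables takes the torus to the diamond and the symbol to `1 - triF / 3`. Put `a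
= u / √2`, `b = v / √2`. Then `triF + 1 = 2 cos a (cos a + cos b)`, and `cos a + cos b > 0` on the
diamond (`neg_cos_lt_cos`), so the sign of `cos a` is the sign of `triF + 1`. Hence, for the level
`c = 4 - 3E` of `triF + 1`, superlevel sections with `c > 0` and sublevel sections with `c ≤ 0` are
intervals of length `2 arccos (c / (2t) - t)`, `t = cos a`, which the diamond does not cut. Fubini
and the substitution `t = cos a` produce the two integrals; the threshold `E = 4/3` is `c = 0`. -/

/-! ### Multiplication operators: functional calculus, spectral projectors, eigenvalues -/

noncomputable section MultiplicationOperators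

open MeasureTheory
open scoped ENNReal

variable {X : Type*} [TopologicalSpace X] [CompactSpace X] [MeasurableSpace X] [BorelSpace X]
  (μ : Measure X) [IsFiniteMeasure μ]

/-- Multiplication by a continuous function on `L²(μ)`. -/
def mulOperator (h : C(X, ℂ)) : Lp ℂ 2 μ →L[ℂ] Lp ℂ 2 μ :=
  (ContinuousLinearMap.mul ℂ ℂ).holderL μ ∞ 2 2 (h.toLp ∞ μ ℂ)

theorem coeFn_mulOperator (h : C(X, ℂ)) (f : Lp ℂ 2 μ) :
    mulOperator μ h f =ᵐ[μ] fun x => h x * f x := by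
  have h1 := (ContinuousLinearMap.mul ℂ ℂ).coeFn_holder (r := 2) (h.toLp ∞ μ ℂ) f
  filter_upwards [h1, ContinuousMap.coeFn_toLp (p := ∞) (𝕜 := ℂ) μ h] with x hx hx'
  rw [← hx']
  exact hx

theorem mulOperator_toLp (h g : C(X, ℂ)) :
    mulOperator μ h (g.toLp 2 μ ℂ) = (h * g).toLp 2 μ ℂ := by
  refine Lp.ext ?_
  filter_upwards [coeFn_mulOperator μ h (g.toLp 2 μ ℂ), ContinuousMap.coeFn_toLp (p := 2) (𝕜 := ℂ) μ g,
    ContinuousMap.coeFn_toLp (p := 2) (𝕜 := ℂ) μ (h * g)] with x h1 h2 h3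
  rw [h1, h2, h3]
  rfl

theorem inner_mulOperator (h : C(X, ℂ)) (f g : Lp ℂ 2 μ) :
    inner ℂ (mulOperator μ (star h) f) g = inner ℂ f (mulOperator μ h g) := by
  rw [L2.inner_def, L2.inner_def]
  refine integral_congr_ae ?_
  filter_upwards [coeFn_mulOperator μ (star h) f, coeFn_mulOperator μ h g] with x h1 h2
  rw [h1, h2]
  simp only [ContinuousMap.star_apply, RCLike.inner_apply, map_mul, RCLike.star_def,
    RCLike.conj_conj]
  ring

variable {ι : Type*} (U : Lp ℂ 2 μ ≃ₗᵢ[ℂ] EllTwo ι)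

/-- The representation of continuous functions on `ℓ²(ι)` by multiplication operators, through a
unitary map from `L²(μ)`. -/
def mulRep : C(X, ℂ) →⋆ₐ[ℂ] (EllTwo ι →L[ℂ] EllTwo ι) where
  toFun h := (U : Lp ℂ 2 μ →L[ℂ] EllTwo ι) ∘L mulOperator μ h ∘L
    (U.symm : EllTwo ι →L[ℂ] Lp ℂ 2 μ)
  map_one' := by
    refine ContinuousLinearMap.ext fun f => ?_
    have : mulOperator μ 1 (U.symm f) = U.symm f := by
      refine Lp.ext ?_
      filter_upwards [coeFn_mulOperator μ 1 (U.symm f)] with x hx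
      simp [hx]
    simp [this]
  map_mul' h g := by
    refine ContinuousLinearMap.ext fun f => ?_
    have : mulOperator μ (h * g) (U.symm f) = mulOperator μ h (mulOperator μ g (U.symm f)) := by
      refine Lp.ext ?_
      filter_upwards [coeFn_mulOperator μ (h * g) (U.symm f),
        coeFn_mulOperator μ h (mulOperator μ g (U.symm f)),
        coeFn_mulOperator μ g (U.symm f)] with x h1 h2 h3
      rw [h1, h2, h3, ContinuousMap.mul_apply, mul_assoc]
    simp [this]
  map_zero' := by
    refine ContinuousLinearMap.ext fun f => ?_
    simp [mulOperator]
  map_add' h g := by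
    refine ContinuousLinearMap.ext fun f => ?_
    simp [mulOperator]
  commutes' c := by
    refine ContinuousLinearMap.ext fun f => ?_
    have : mulOperator μ (algebraMap ℂ C(X, ℂ) c) (U.symm f) = c • U.symm f := by
      refine Lp.ext ?_
      filter_upwards [coeFn_mulOperator μ (algebraMap ℂ C(X, ℂ) c) (U.symm f),
        Lp.coeFn_smul c (U.symm f)] with x h1 h2
      rw [h1, h2]
      simp
    rw [ContinuousLinearMap.comp_apply, ContinuousLinearMap.comp_apply]
    change U (mulOperator μ (algebraMap ℂ C(X, ℂ) c) (U.symm f)) = _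
    rw [this, map_smul, U.apply_symm_apply, Algebra.algebraMap_eq_smul_one]
    rfl
  map_star' h := by
    rw [ContinuousLinearMap.star_eq_adjoint]
    refine (ContinuousLinearMap.eq_adjoint_iff _ _).2 fun f g => ?_
    have := inner_mulOperator μ h (U.symm f) (U.symm g)
    simp only [ContinuousLinearMap.comp_apply]
    rw [← U.symm.inner_map_map, ← U.symm.inner_map_map]
    simpa using this

theorem mulRep_apply (h : C(X, ℂ)) (f : EllTwo ι) :
    mulRep μ U h f = U (mulOperator μ h (U.symm f)) := rfl

/-- A real valued continuous function, as a complex valued one. -/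
def ofRealMap (φ : C(X, ℝ)) : C(X, ℂ) := ⟨fun x => (φ x : ℂ), by fun_prop⟩

omit [CompactSpace X] [MeasurableSpace X] [BorelSpace X] in
theorem isSelfAdjoint_ofRealMap (φ : C(X, ℝ)) : IsSelfAdjoint (ofRealMap φ) := by
  ext x
  simp [ofRealMap]

/-- The continuous functional calculus of a self-adjoint element of a C⋆-algebra. -/
def realCfc {A : Type*} [CStarAlgebra A] (f : ℝ → ℝ) (a : A) : A := cfc f a

theorem map_realCfc {A B : Type*} [CStarAlgebra A] [CStarAlgebra B] (ψ : A →⋆ₐ[ℂ] B) (f : C(ℝ, ℝ))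
    {a : A} (ha : IsSelfAdjoint a) : ψ (realCfc f a) = realCfc f (ψ a) :=
  StarAlgHomClass.map_cfc (R := ℝ) (S := ℂ) (p := IsSelfAdjoint) (q := IsSelfAdjoint)
    ψ f a (by fun_prop)
    (AddMonoidHomClass.continuous_of_bound ψ 1 fun x => by
      simpa using NonUnitalStarAlgHom.norm_apply_le ψ x) ha (ha.map ψ)

theorem realCfc_ofReal (f : ℝ → ℝ) (r : ℝ) : realCfc f (r : ℂ) = (f r : ℂ) :=
  cfc_algebraMap r f

-- Evaluation at a point is a star homomorphism to `ℂ`, so naturality of the functional calculus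
-- reduces the claim to scalars.
omit [MeasurableSpace X] [BorelSpace X] in
theorem realCfc_ofRealMap (φ : C(X, ℝ)) (f : C(ℝ, ℝ)) :
    realCfc f (ofRealMap φ) = ofRealMap (f.comp φ) := by
  ext x
  exact (map_realCfc (ContinuousMap.evalStarAlgHom ℂ ℂ x) f (isSelfAdjoint_ofRealMap φ)).trans
    (realCfc_ofReal f (φ x))

theorem realCfc_mulRep (φ : C(X, ℝ)) (f : C(ℝ, ℝ)) :
    realCfc f (mulRep μ U (ofRealMap φ)) = mulRep μ U (ofRealMap (f.comp φ)) := by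
  rw [← realCfc_ofRealMap]
  exact (map_realCfc (mulRep μ U) f (isSelfAdjoint_ofRealMap φ)).symm

theorem spectralProjector_mulRep (φ : C(X, ℝ)) (f : C(ℝ, ℝ)) (E : ℝ)
    (hf : ∀ x, f x = max (x - E) 0) :
    spectralProjector (mulRep μ U (ofRealMap φ)) E
      = (mulRep μ U (ofRealMap (f.comp φ))).ker.starProjection := by
  have h : (fun x : ℝ => max (x - E) 0) = f := funext fun x => (hf x).symm
  have h2 : spectralProjector (mulRep μ U (ofRealMap φ)) E
      = (realCfc (fun x : ℝ => max (x - E) 0) (mulRep μ U (ofRealMap φ))).ker.starProjection := rfl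
  rw [h2]
  congr 1
  rw [h, realCfc_mulRep]

/-- The diagonal matrix elements of spectral projectors of a multiplication operator. -/
theorem inner_spectralProjector_mulRep (φ : C(X, ℝ)) (E : ℝ) (e : C(X, ℂ)) (he : ∀ x, ‖e x‖ = 1) :
    inner ℂ (U (e.toLp 2 μ ℂ)) (spectralProjector (mulRep μ U (ofRealMap φ)) E (U (e.toLp 2 μ ℂ)))
      = (μ.real {x | φ x ≤ E} : ℂ) := by
  have hS : MeasurableSet {x | φ x ≤ E} := measurableSet_le φ.continuous.measurable measurable_const
  have hmem : MemLp ({x | φ x ≤ E}.indicator e) 2 μ :=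
    MemLp.indicator hS (MemLp.of_bound (C := 1) e.continuous.aestronglyMeasurable
      (.of_forall fun x => (he x).le))
  set y : Lp ℂ 2 μ := hmem.toLp
  have hy : y =ᵐ[μ] {x | φ x ≤ E}.indicator e := hmem.coeFn_toLp
  have he' := ContinuousMap.coeFn_toLp (p := 2) (𝕜 := ℂ) μ e
  let f : C(ℝ, ℝ) := ⟨fun x => max (x - E) 0, by fun_prop⟩
  have hker : ∀ z, z ∈ (mulRep μ U (ofRealMap (f.comp φ))).ker ↔
      ∀ᵐ x ∂μ, ((max (φ x - E) 0 : ℝ) : ℂ) * U.symm z x = 0 := by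
    intro z
    rw [LinearMap.mem_ker]
    change mulRep μ U (ofRealMap (f.comp φ)) z = 0 ↔ _
    rw [mulRep_apply, map_eq_zero_iff _ U.injective, Lp.eq_zero_iff_ae_eq_zero]
    have h3 := coeFn_mulOperator μ (ofRealMap (f.comp φ)) (U.symm z)
    constructor
    · intro h
      filter_upwards [h, h3] with x hx hx'
      rw [hx'] at hx
      exact hx
    · intro h
      filter_upwards [h, h3] with x hx hx'
      rw [hx']
      exact hx
  -- The projection is identified by its two defining properties: the truncated function `y` lies in
  -- the kernel, and `e - y` is orthogonal to it, because elements of the kernel vanish a.e. where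
  -- `φ > E`.
  have hP : spectralProjector (mulRep μ U (ofRealMap φ)) E (U (e.toLp 2 μ ℂ)) = U y := by
    rw [spectralProjector_mulRep μ U φ f E fun _ => rfl]
    refine Submodule.eq_starProjection_of_mem_of_inner_eq_zero ((hker _).2 ?_) fun w hw => ?_
    · rw [U.symm_apply_apply]
      filter_upwards [hy] with x hx
      rw [hx]
      by_cases hxE : φ x ≤ E
      · simp [hxE]
      · simp [hxE]
    · rw [← U.symm.inner_map_map, map_sub, U.symm_apply_apply, U.symm_apply_apply, L2.inner_def,
        integral_eq_zero_of_ae]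
      filter_upwards [hy, he', (hker w).1 hw, Lp.coeFn_sub (e.toLp 2 μ ℂ) y] with x h1 h2 h3 h4
      rw [h4, Pi.sub_apply, h1, h2]
      by_cases hxE : φ x ≤ E
      · simp [hxE]
      · have : ((max (φ x - E) 0 : ℝ) : ℂ) ≠ 0 := by
          rw [max_eq_left (by linarith)]
          exact_mod_cast (by linarith : φ x - E ≠ 0)
        simp [(mul_eq_zero.1 h3).resolve_left this]
  rw [hP, U.inner_map_map, L2.inner_def]
  have : ∀ᵐ x ∂μ, inner ℂ ((e.toLp 2 μ ℂ) x) (y x) = {x | φ x ≤ E}.indicator (fun _ => (1 : ℂ)) x := by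
    filter_upwards [hy, he'] with x h1 h2
    rw [h1, h2]
    by_cases hxE : φ x ≤ E
    · simp [hxE, he]
    · simp [hxE]
  rw [integral_congr_ae this, integral_indicator hS]
  simp

/-- A multiplication operator has no eigenvalues if the level sets of the symbol are null. -/
theorem not_hasEigenvalue_mulRep (φ : C(X, ℝ)) (hφ : ∀ c, μ {x | φ x = c} = 0) (z : ℂ) :
    ¬ Module.End.HasEigenvalue (mulRep μ U (ofRealMap φ) : Module.End ℂ (EllTwo ι)) z := by
  intro h
  obtain ⟨f, hf⟩ := h.exists_hasEigenvector
  apply hf.2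
  have h1 : mulRep μ U (ofRealMap φ) f = z • f := hf.apply_eq_smul
  rw [mulRep_apply, ← U.symm.injective.eq_iff, U.symm_apply_apply, map_smul] at h1
  rw [← map_eq_zero_iff _ U.symm.injective, Lp.eq_zero_iff_ae_eq_zero]
  -- As `φ` is real, `φ x = z` forces `φ x = z.re`; excluding this one null level set covers every
  -- complex `z`.
  have h2 : ∀ᵐ x ∂μ, φ x ≠ z.re := by
    rw [ae_iff]
    simpa using hφ z.re
  filter_upwards [coeFn_mulOperator μ (ofRealMap φ) (U.symm f), Lp.coeFn_smul z (U.symm f), h2]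
    with x h3 h4 h5
  rw [h1, h4] at h3
  have h6 : ((φ x : ℂ) - z) * U.symm f x = 0 := by
    have : z * U.symm f x = φ x * U.symm f x := h3
    rw [sub_mul, this, sub_self]
  refine (mul_eq_zero.1 h6).resolve_left fun h7 => h5 ?_
  simpa using congrArg Complex.re (sub_eq_zero.1 h7)

end MultiplicationOperators

/-! ### Fourier series on the torus and diagonalisation of the Laplacian -/

noncomputable section FourierTransform

open MeasureTheory AddCircle
open scoped ENNReal

/-- The Haar probability measure on the two dimensional torus `(ℝ / ℤ)²`. -/
abbrev torusMeasure : Measure (UnitAddTorus (Fin 2)) := Measure.pi fun _ => haarAddCircle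

/-- The character of the torus `(ℝ / ℤ)²` attached to a vertex. -/
def torusCharacter (v : ℤ × ℤ) : C(UnitAddTorus (Fin 2), ℂ) := UnitAddTorus.mFourier ![v.1, v.2]

theorem torusCharacter_apply (v : ℤ × ℤ) (x : UnitAddTorus (Fin 2)) :
    torusCharacter v x = fourier v.1 (x 0) * fourier v.2 (x 1) := by
  simp [torusCharacter, UnitAddTorus.mFourier]

theorem torusCharacter_add (v w : ℤ × ℤ) :
    torusCharacter (v + w) = torusCharacter v * torusCharacter w := by
  ext x
  simp only [torusCharacter_apply, ContinuousMap.mul_apply, Prod.fst_add, Prod.snd_add, fourier_add]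
  ring

theorem torusCharacter_neg (v : ℤ × ℤ) (x : UnitAddTorus (Fin 2)) :
    torusCharacter (-v) x = starRingEnd ℂ (torusCharacter v x) := by
  simp only [torusCharacter_apply, Prod.fst_neg, Prod.snd_neg, fourier_neg, map_mul]

theorem norm_torusCharacter (v : ℤ × ℤ) (x : UnitAddTorus (Fin 2)) : ‖torusCharacter v x‖ = 1 := by
  rw [torusCharacter_apply, norm_mul]
  exact (congrArg₂ _ (Circle.norm_coe _) (Circle.norm_coe _)).trans (one_mul 1)

theorem torusCharacter_coe (v : ℤ × ℤ) (s : Fin 2 → ℝ) :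
    torusCharacter v (fun i => (s i : UnitAddCircle))
      = Complex.exp ((2 * Real.pi * (v.1 * s 0 + v.2 * s 1) : ℝ) * Complex.I) := by
  simp only [torusCharacter_apply, fourier_coe_apply, ← Complex.exp_add]
  congr 1
  push_cast
  ring

theorem pair_injective : Function.Injective fun v : ℤ × ℤ => ![v.1, v.2] := by
  intro v w h
  exact Prod.ext (congrFun h 0) (congrFun h 1)

theorem orthonormal_torusCharacter :
    Orthonormal ℂ fun v => (torusCharacter v).toLp 2 torusMeasure ℂ :=
  (UnitAddTorus.orthonormal_mFourier (d := Fin 2)).comp _ pair_injective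

theorem span_torusCharacter :
    ⊤ ≤ (Submodule.span ℂ
      (Set.range fun v => (torusCharacter v).toLp 2 torusMeasure ℂ)).topologicalClosure := by
  have h := UnitAddTorus.span_mFourierLp_closure_eq_top (d := Fin 2) (p := 2) (by simp)
  have h2 : (Set.range fun v => (torusCharacter v).toLp 2 torusMeasure ℂ)
      = Set.range (UnitAddTorus.mFourierLp (d := Fin 2) 2) := by
    refine Set.Subset.antisymm ?_ ?_
    · rintro _ ⟨v, rfl⟩
      exact ⟨![v.1, v.2], rfl⟩
    · rintro _ ⟨n, rfl⟩
      refine ⟨(n 0, n 1), ?_⟩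
      have : ![n 0, n 1] = n := by
        ext i
        fin_cases i <;> rfl
      change ContinuousMap.toLp 2 torusMeasure ℂ (UnitAddTorus.mFourier ![n 0, n 1]) = _
      rw [this]
      rfl
  rw [h2]
  exact h.ge

/-- The characters of the torus, as a Hilbert basis of `L²`. -/
def torusBasis : HilbertBasis (ℤ × ℤ) ℂ (Lp ℂ 2 torusMeasure) :=
  HilbertBasis.mk orthonormal_torusCharacter span_torusCharacter

theorem torusBasis_apply (v : ℤ × ℤ) :
    torusBasis v = (torusCharacter v).toLp 2 torusMeasure ℂ := by
  simp [torusBasis]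

/-- The symbol of the Laplacian of the triangular lattice. -/
def triSymbol : C(UnitAddTorus (Fin 2), ℝ) where
  toFun x := 1 - ((torusCharacter (1, 0) x).re + (torusCharacter (0, 1) x).re
    + (torusCharacter (1, -1) x).re) / 3

/-- Multiplying characters adds their frequencies, and the six neighbours form three opposite pairs,
each contributing twice a real part. -/
theorem ofRealMap_triSymbol_mul (v : ℤ × ℤ) :
    ofRealMap triSymbol * torusCharacter v
      = torusCharacter v - (1 / 6 : ℂ) • ∑ w ∈ triNeighbors v, torusCharacter w := by
  have h : ∑ w ∈ triNeighbors v, torusCharacter w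
      = torusCharacter v * (torusCharacter (1, 0) + torusCharacter (-(1, 0)) + torusCharacter (0, 1)
        + torusCharacter (-(0, 1)) + torusCharacter (-(1, -1)) + torusCharacter (1, -1)) := by
    obtain ⟨a, b⟩ := v
    simp only [mul_add, ← torusCharacter_add]
    simp [triNeighbors, Finset.sum_insert, add_assoc]
  rw [h]
  ext x
  have hre : ∀ w, torusCharacter w x + torusCharacter (-w) x = ((torusCharacter w x).re : ℂ) * 2 := by
    intro w
    rw [torusCharacter_neg, Complex.add_conj]
    push_cast
    ring
  simp only [ofRealMap, triSymbol, ContinuousMap.mul_apply, ContinuousMap.sub_apply,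
    ContinuousMap.smul_apply, ContinuousMap.add_apply, ContinuousMap.coe_mk, smul_eq_mul]
  push_cast
  linear_combination (torusCharacter v x / 6) * (hre (1, 0) + hre (0, 1) + hre (1, -1))

/-- Compared coefficient by coefficient: the real symbol can be moved onto the character in the
inner product, where it turns into the finite neighbour sum. -/
theorem triLaplacian_eq_mulRep :
    triLaplacian = mulRep torusMeasure torusBasis.repr (ofRealMap triSymbol) := by
  refine ContinuousLinearMap.ext fun f => lp.ext (funext fun v => ?_)
  have hf : ∀ w, f w = inner ℂ ((torusCharacter w).toLp 2 torusMeasure ℂ) (torusBasis.repr.symm f) := by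
    intro w
    rw [← torusBasis_apply, ← torusBasis.repr_apply_apply, LinearIsometryEquiv.apply_symm_apply]
  rw [graphLaplacian_apply, mulRep_apply, HilbertBasis.repr_apply_apply, ← inner_mulOperator,
    IsSelfAdjoint.star_eq (isSelfAdjoint_ofRealMap triSymbol), torusBasis_apply, mulOperator_toLp,
    ofRealMap_triSymbol_mul, map_sub, map_smul, map_sum, inner_sub_left, inner_smul_left, sum_inner,
    ← hf, triGraph_degree, triGraph_neighborFinset]
  have h6 : (starRingEnd ℂ) 6 = 6 := Complex.conj_ofNat 6
  simp [hf, h6]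

/-- Some `a ∈ Q` exists because the vertex `0` is covered. Any `b ∈ Q` is both a translate of `a`
and the trivial translate of itself, so uniqueness forces `a = b`. -/
theorem exists_eq_singleton {Q : Finset (ℤ × ℤ)} (hQ : IsVertexFundamentalDomain triTranslate Q) :
    ∃ a, Q = {a} := by
  obtain ⟨⟨γ, a⟩, ⟨ha, -⟩, -⟩ := hQ 0
  refine ⟨a, Finset.eq_singleton_iff_unique_mem.2 ⟨ha, fun b hb => ?_⟩⟩
  have h := (hQ b).unique (y₁ := (b - a, a)) (y₂ := (0, b)) ⟨ha, by simp [triTranslate]⟩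
    ⟨hb, by simp [triTranslate]⟩
  exact (congrArg Prod.snd h).symm

/-- The integrated density of states is the distribution function of the symbol. -/
theorem triIDS_eq_torusMeasure {Q : Finset (ℤ × ℤ)} (hQ : IsVertexFundamentalDomain triTranslate Q)
    (E : ℝ) : triIDS Q E = torusMeasure.real {x | triSymbol x ≤ E} := by
  obtain ⟨a, rfl⟩ := exists_eq_singleton hQ
  have hb : ∀ v, (lp.single 2 v (1 : ℂ) : EllTwo (ℤ × ℤ))
      = torusBasis.repr ((torusCharacter v).toLp 2 torusMeasure ℂ) := by
    intro v
    rw [← torusBasis_apply, HilbertBasis.repr_self]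
  have hind : ∀ (v : ℤ × ℤ) (g : EllTwo (ℤ × ℤ)),
      inner ℂ (lp.single 2 v (1 : ℂ) : EllTwo (ℤ × ℤ)) (indicatorOperator (({a} : Finset (ℤ × ℤ)) : Set (ℤ × ℤ)) g)
        = if v = a then g a else 0 := by
    intro v g
    rw [lp.inner_single_left]
    change inner ℂ (1 : ℂ) (Set.indicator _ g v) = _
    by_cases h : v = a <;> simp [h]
  have htr : ellTwoTrace (indicatorOperator (({a} : Finset (ℤ × ℤ)) : Set (ℤ × ℤ)) ∘L
      spectralProjector triLaplacian E) = (torusMeasure.real {x | triSymbol x ≤ E} : ℂ) := by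
    -- The indicator of `{a}` kills every diagonal entry except the one at `a`.
    rw [ellTwoTrace, tsum_eq_single a]
    · rw [ContinuousLinearMap.comp_apply, hind, if_pos rfl,
        ← inner_spectralProjector_mulRep torusMeasure torusBasis.repr triSymbol E (torusCharacter a)
          (norm_torusCharacter a), ← hb, ← triLaplacian_eq_mulRep, lp.inner_single_left]
      simp
    · intro v hv
      rw [ContinuousLinearMap.comp_apply, hind, if_neg hv]
  change (1 / ((({a} : Finset (ℤ × ℤ)).card : ℕ) : ℝ)) * (ellTwoTrace _).re = _
  rw [htr]
  simp

end FourierTransform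

/-! ### From the torus to the diamond; null level sets and continuity -/

noncomputable section Coordinates

open MeasureTheory AddCircle
open scoped ENNReal

/-- The open square, which differs from a half-open period cell by a null set, is used because the
diamond is open. -/
theorem measurePreserving_square_torus :
    MeasurePreserving (fun (s : ℝ × ℝ) (i : Fin 2) => ((![s.1, s.2] i : ℝ) : UnitAddCircle))
      (volume.restrict (Set.Ioo (-1 / 2 : ℝ) (1 / 2) ×ˢ Set.Ioo (-1 / 2 : ℝ) (1 / 2)))
      torusMeasure := by
  have h1 : MeasurePreserving ((↑) : ℝ → UnitAddCircle)
      (volume.restrict (Set.Ioo (-1 / 2 : ℝ) (1 / 2))) haarAddCircle := by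
    have h := UnitAddCircle.measurePreserving_mk (-1 / 2)
    rw [AddCircle.volume_eq_smul_haarAddCircle, ENNReal.ofReal_one, one_smul,
      show (-1 / 2 + 1 : ℝ) = 1 / 2 by norm_num, ← Measure.restrict_congr_set Ioo_ae_eq_Ioc] at h
    exact h
  have h2 := measurePreserving_pi (fun _ : Fin 2 => volume.restrict (Set.Ioo (-1 / 2 : ℝ) (1 / 2)))
    (fun _ : Fin 2 => haarAddCircle) (fun _ => h1)
  have h3 := (measurePreserving_finTwoArrow (volume.restrict (Set.Ioo (-1 / 2 : ℝ) (1 / 2)))).symm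
  rw [Measure.prod_restrict] at h3
  exact h2.comp h3

theorem triSymbol_coe (s : Fin 2 → ℝ) :
    triSymbol (fun i => (s i : UnitAddCircle)) = 1 - (Real.cos (2 * Real.pi * s 0)
      + Real.cos (2 * Real.pi * s 1) + Real.cos (2 * Real.pi * s 0 - 2 * Real.pi * s 1)) / 3 := by
  simp only [triSymbol, ContinuousMap.coe_mk, torusCharacter_coe, Complex.exp_ofReal_mul_I_re]
  push_cast
  ring_nf

/-- The linear map taking the diamond to the unit square. -/
def diamondMap : ℝ × ℝ →ₗ[ℝ] ℝ × ℝ :=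
  Matrix.toLin (Module.Basis.finTwoProd ℝ) (Module.Basis.finTwoProd ℝ)
    !![1 / (2 * Real.pi * √2), 1 / (2 * Real.pi * √2);
      -(1 / (2 * Real.pi * √2)), 1 / (2 * Real.pi * √2)]

theorem diamondMap_apply (p : ℝ × ℝ) :
    diamondMap p = ((p.1 + p.2) / (2 * Real.pi * √2), (p.2 - p.1) / (2 * Real.pi * √2)) := by
  rw [diamondMap, Matrix.toLin_finTwoProd_apply]
  ext <;> simp <;> ring

theorem det_diamondMap : LinearMap.det diamondMap = 1 / (2 * Real.pi) ^ 2 := by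
  rw [diamondMap, LinearMap.det_toLin, Matrix.det_fin_two_of]
  have h2 : √2 ^ 2 = 2 := Real.sq_sqrt (by norm_num)
  have hp := Real.pi_pos
  field_simp
  rw [h2]
  norm_num

theorem diamondMap_mem_iff (p : ℝ × ℝ) :
    diamondMap p ∈ Set.Ioo (-1 / 2 : ℝ) (1 / 2) ×ˢ Set.Ioo (-1 / 2 : ℝ) (1 / 2)
      ↔ p ∈ triDiamond := by
  have hk : 0 < 2 * Real.pi * √2 := by positivity
  rw [diamondMap_apply, triDiamond, Set.mem_prod, Set.mem_Ioo, Set.mem_Ioo, Set.mem_ofPred_eq,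
    div_lt_iff₀ hk, lt_div_iff₀ hk, div_lt_iff₀ hk, lt_div_iff₀ hk]
  constructor
  · rintro ⟨⟨h1, h2⟩, h3, h4⟩
    rcases abs_cases p.1 with ⟨h, -⟩ | ⟨h, -⟩ <;> rcases abs_cases p.2 with ⟨h', -⟩ | ⟨h', -⟩ <;>
      linarith
  · intro h
    have := le_abs_self p.1
    have := neg_abs_le p.1
    have := le_abs_self p.2
    have := neg_abs_le p.2
    refine ⟨⟨?_, ?_⟩, ?_, ?_⟩ <;> linarith

/-- The angles become `b + a` and `b - a` with `a = u / √2`, `b = v / √2`. Their cosines add up to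
`2 cos a cos b`, and their difference `2a` contributes `2 cos² a - 1`. -/
theorem triSymbol_diamondMap (p : ℝ × ℝ) :
    triSymbol (fun i => ((![(diamondMap p).1, (diamondMap p).2] i : ℝ) : UnitAddCircle))
      = 1 - triF p / 3 := by
  have h2 : √2 ≠ 0 := by positivity
  have hp := Real.pi_ne_zero
  rw [triSymbol_coe, diamondMap_apply, triF]
  simp only [Matrix.cons_val_zero, Matrix.cons_val_one]
  rw [show 2 * Real.pi * ((p.1 + p.2) / (2 * Real.pi * √2)) = p.1 / √2 + p.2 / √2 by field_simp,
    show 2 * Real.pi * ((p.2 - p.1) / (2 * Real.pi * √2)) = p.2 / √2 - p.1 / √2 by field_simp,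
    show p.1 / √2 + p.2 / √2 - (p.2 / √2 - p.1 / √2) = 2 * (p.1 / √2) by ring,
    Real.cos_add, Real.cos_sub, Real.cos_two_mul]
  ring

/-- The distribution of the symbol, computed on the diamond. -/
theorem torusMeasure_triSymbol_preimage {S : Set ℝ} (hS : MeasurableSet S) :
    torusMeasure {x | triSymbol x ∈ S} = ENNReal.ofReal (1 / (2 * Real.pi) ^ 2) *
      volume {p : ℝ × ℝ | p ∈ triDiamond ∧ 1 - triF p / 3 ∈ S} := by
  have hm : MeasurableSet {x | triSymbol x ∈ S} := triSymbol.continuous.measurable hS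
  have hpos : (0 : ℝ) < (2 * Real.pi) ^ 2 := by positivity
  have hdet : LinearMap.det diamondMap ≠ 0 := by
    rw [det_diamondMap]
    positivity
  have hpre : MeasurableSet ((fun (s : ℝ × ℝ) (i : Fin 2) =>
      ((![s.1, s.2] i : ℝ) : UnitAddCircle)) ⁻¹' {x | triSymbol x ∈ S}) :=
    measurePreserving_square_torus.measurable hm
  -- A linear preimage scales volume by the inverse determinant, here `(2π)²`, which the prefactor
  -- cancels.
  have h := Measure.addHaar_preimage_linearMap (volume : Measure (ℝ × ℝ)) hdet
    ((fun (s : ℝ × ℝ) (i : Fin 2) => ((![s.1, s.2] i : ℝ) : UnitAddCircle)) ⁻¹'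
      {x | triSymbol x ∈ S} ∩ Set.Ioo (-1 / 2 : ℝ) (1 / 2) ×ˢ Set.Ioo (-1 / 2 : ℝ) (1 / 2))
  rw [← Measure.restrict_apply hpre,
    measurePreserving_square_torus.measure_preimage hm.nullMeasurableSet, det_diamondMap] at h
  have hset : {p : ℝ × ℝ | p ∈ triDiamond ∧ 1 - triF p / 3 ∈ S} = diamondMap ⁻¹'
      ((fun (s : ℝ × ℝ) (i : Fin 2) => ((![s.1, s.2] i : ℝ) : UnitAddCircle)) ⁻¹'
      {x | triSymbol x ∈ S} ∩ Set.Ioo (-1 / 2 : ℝ) (1 / 2) ×ˢ Set.Ioo (-1 / 2 : ℝ) (1 / 2)) := by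
    ext p
    rw [Set.mem_preimage, Set.mem_inter_iff, diamondMap_mem_iff, Set.mem_preimage, Set.mem_ofPred_eq,
      Set.mem_ofPred_eq, triSymbol_diamondMap, and_comm]
  rw [hset, h, ← mul_assoc, ← ENNReal.ofReal_mul (by positivity), one_div, inv_inv,
    abs_of_pos hpos, inv_mul_cancel₀ hpos.ne', ENNReal.ofReal_one, one_mul]

theorem continuous_triF : Continuous triF := by
  unfold triF
  fun_prop

theorem torusMeasure_real_triSymbol_preimage {S : Set ℝ} (hS : MeasurableSet S) :
    torusMeasure.real {x | triSymbol x ∈ S} = 1 / (2 * Real.pi) ^ 2 *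
      volume.real {p : ℝ × ℝ | p ∈ triDiamond ∧ 1 - triF p / 3 ∈ S} := by
  rw [Measure.real, torusMeasure_triSymbol_preimage hS, ENNReal.toReal_mul,
    ENNReal.toReal_ofReal (by positivity), Measure.real]

/-- The level sets of `triF` are null. -/
theorem volume_triF_eq (c : ℝ) : volume {p : ℝ × ℝ | triF p = c} = 0 := by
  have hs : 0 < √2 := by positivity
  have hcount : ∀ d : ℝ, {x : ℝ | Real.cos (x / √2) = d}.Countable := by
    intro d
    have h1 : {x : ℝ | Real.cos x = d}.Countable := by
      by_cases hd : ∃ y, Real.cos y = d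
      · obtain ⟨y, rfl⟩ := hd
        refine ((Set.countable_range fun k : ℤ => 2 * k * Real.pi + y).union
          (Set.countable_range fun k : ℤ => 2 * k * Real.pi - y)).mono fun x hx => ?_
        obtain ⟨k, hk | hk⟩ := Real.cos_eq_cos_iff.1 (Eq.symm hx)
        · exact Or.inl ⟨k, hk.symm⟩
        · exact Or.inr ⟨k, hk.symm⟩
      · have : {x : ℝ | Real.cos x = d} = ∅ := by
          ext x
          simpa using fun h => hd ⟨x, h⟩
        rw [this]
        exact Set.countable_empty
    exact h1.preimage (f := fun x : ℝ => x / √2) fun x y h => by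
      simpa [div_left_inj' hs.ne'] using h
  have hm : MeasurableSet {p : ℝ × ℝ | triF p = c} :=
    measurableSet_eq_fun continuous_triF.measurable measurable_const
  rw [Measure.volume_eq_prod, Measure.measure_prod_null hm]
  -- Off this null set of `x` the equation `triF = c` determines `cos (y / √2)`, so the section is
  -- countable.
  have h0 : ∀ᵐ x : ℝ, Real.cos (x / √2) ≠ 0 := by
    rw [ae_iff]
    simpa using (hcount 0).measure_zero volume
  filter_upwards [h0] with x hx
  refine ((hcount ((c + 1 - 2 * Real.cos (x / √2) ^ 2) / (2 * Real.cos (x / √2)))).mono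
    fun y hy => ?_).measure_zero volume
  have hy' : 2 * Real.cos (x / √2) * Real.cos (y / √2) + 2 * Real.cos (x / √2) ^ 2 - 1 = c := hy
  rw [Set.mem_ofPred_eq, eq_div_iff (by simpa using hx)]
  linarith

theorem torusMeasure_triSymbol_eq (c : ℝ) : torusMeasure {x | triSymbol x = c} = 0 := by
  have h := torusMeasure_triSymbol_preimage (measurableSet_singleton c)
  simp only [Set.mem_singleton_iff] at h
  rw [h, measure_mono_null _ (volume_triF_eq (3 - 3 * c)), mul_zero]
  rintro p ⟨-, hp⟩
  rw [Set.mem_ofPred_eq]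
  linarith

/-- The distribution function of a function with null level sets is continuous. -/
theorem continuous_measureReal_le {X : Type*} [MeasurableSpace X] {μ : Measure X}
    [IsFiniteMeasure μ] {φ : X → ℝ} (hφ : Measurable φ) (h0 : ∀ c, μ {x | φ x = c} = 0) :
    Continuous fun E : ℝ => μ.real {x | φ x ≤ E} := by
  have hm : ∀ E : ℝ, MeasurableSet {x | φ x ≤ E} := fun E => measurableSet_le hφ measurable_const
  have h : (fun E : ℝ => μ.real {x | φ x ≤ E})
      = fun E => ∫ x, {x | φ x ≤ E}.indicator (fun _ => (1 : ℝ)) x ∂μ := by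
    funext E
    rw [integral_indicator (hm E)]
    simp
  rw [h, continuous_iff_continuousAt]
  intro E₀
  refine continuousAt_of_dominated (bound := fun _ => 1)
    (.of_forall fun E => (measurable_const.indicator (hm E)).aestronglyMeasurable)
    (.of_forall fun E => .of_forall fun x => ?_) (integrable_const 1) ?_
  · exact (norm_indicator_le_norm_self _ x).trans (by simp)
  -- For fixed `x` the indicator is locally constant in `E` away from `E = φ x`.
  · have hne : ∀ᵐ x ∂μ, φ x ≠ E₀ := by
      rw [ae_iff]
      simpa using h0 E₀
    filter_upwards [hne] with x hx
    rcases lt_or_gt_of_ne hx with hlt | hgt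
    · refine continuousAt_const (y := (1 : ℝ)) |>.congr ?_
      filter_upwards [lt_mem_nhds hlt] with E hE
      simp [hE.le]
    · refine continuousAt_const (y := (0 : ℝ)) |>.congr ?_
      filter_upwards [gt_mem_nhds hgt] with E hE
      simp [hE]

end Coordinates

/-! ### Areas of level regions by Fubini and the substitution `t = cos a` -/

section Integrals

open MeasureTheory

theorem image_cos_Ioo : Real.cos '' Set.Ioo 0 Real.pi = Set.Ioo (-1) 1 := by
  ext t
  constructor
  · rintro ⟨x, ⟨h0, hπ⟩, rfl⟩
    constructor
    · simpa using Real.strictAntiOn_cos ⟨h0.le, hπ.le⟩ ⟨Real.pi_pos.le, le_rfl⟩ hπ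
    · simpa using Real.strictAntiOn_cos ⟨le_rfl, Real.pi_pos.le⟩ ⟨h0.le, hπ.le⟩ h0
  · rintro ⟨h1, h2⟩
    exact ⟨Real.arccos t, ⟨Real.arccos_pos.2 h2, Real.arccos_lt_pi.2 h1⟩,
      Real.cos_arccos h1.le h2.le⟩

theorem abs_neg_sin_mul_div {x : ℝ} (hx : x ∈ Set.Ioo 0 Real.pi) (y : ℝ) :
    |-Real.sin x| • (y / √(1 - Real.cos x ^ 2)) = y := by
  have hs : 0 < Real.sin x := Real.sin_pos_of_pos_of_lt_pi hx.1 hx.2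
  rw [← Real.sin_sq, Real.sqrt_sq hs.le, abs_neg, abs_of_pos hs, smul_eq_mul]
  field_simp

/-- Under `t = cos x` the weight cancels the Jacobian `sin x`, leaving a bounded function on `(0,
π)`. -/
theorem integrableOn_div_sqrt_one_sub_sq {h : ℝ → ℝ} (hm : Measurable h) {C : ℝ}
    (hC : ∀ t, ‖h t‖ ≤ C) :
    IntegrableOn (fun t => h t / √(1 - t ^ 2)) (Set.Ioo (-1) 1) := by
  rw [← image_cos_Ioo, integrableOn_image_iff_integrableOn_abs_deriv_smul measurableSet_Ioo
    (fun x _ => (Real.hasDerivAt_cos x).hasDerivWithinAt)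
    (Real.injOn_cos.mono Set.Ioo_subset_Icc_self)]
  refine IntegrableOn.congr_fun (f := fun x => h (Real.cos x)) ?_
    (fun x hx => (abs_neg_sin_mul_div hx _).symm) measurableSet_Ioo
  exact Measure.integrableOn_of_bounded (M := C) (by simp)
    (hm.comp Real.measurable_cos).aestronglyMeasurable (.of_forall fun x => hC _)

theorem setIntegral_comp_cos (h : ℝ → ℝ) :
    ∫ x in Set.Ioo 0 Real.pi, h (Real.cos x) = ∫ t in Set.Ioo (-1) 1, h t / √(1 - t ^ 2) := by
  rw [← image_cos_Ioo, integral_image_eq_integral_abs_deriv_smul measurableSet_Ioo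
    (fun x _ => (Real.hasDerivAt_cos x).hasDerivWithinAt)
    (Real.injOn_cos.mono Set.Ioo_subset_Icc_self)]
  exact setIntegral_congr_fun measurableSet_Ioo fun x hx => (abs_neg_sin_mul_div hx _).symm

/-- Fubini for planar regions whose vertical sections depend only on the cosine. -/
theorem volume_real_of_sections {S : Set (ℝ × ℝ)} (hS : MeasurableSet S)
    (hb : ∀ p ∈ S, |p.1| + |p.2| < Real.pi) {A : Set ℝ} (hA : MeasurableSet A) {h : ℝ → ℝ}
    (hsec : ∀ a, |a| < Real.pi →
      volume.real {b | (a, b) ∈ S} = 2 * A.indicator h (Real.cos a)) :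
    volume.real S = 4 * ∫ t in Set.Ioo (-1) 1 ∩ A, h t / √(1 - t ^ 2) := by
  have h1 : volume.real S = ∫ a, volume.real {b | (a, b) ∈ S} := by
    rw [Measure.real, Measure.volume_eq_prod, Measure.prod_apply hS, ← integral_toReal]
    · rfl
    · exact (measurable_measure_prodMk_left hS).aemeasurable
    · refine .of_forall fun a => (measure_mono (t := Set.Ioo (-Real.pi) Real.pi) fun b hab => ?_).trans_lt
        measure_Ioo_lt_top
      exact abs_lt.1 (lt_of_le_of_lt (le_add_of_nonneg_left (abs_nonneg a)) (hb _ hab))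
  have h2 : ∀ a, volume.real {b | (a, b) ∈ S}
      = (Set.Iio Real.pi).indicator (fun x => 2 * A.indicator h (Real.cos x)) |a| := by
    intro a
    by_cases ha : |a| < Real.pi
    · rw [hsec a ha, Set.indicator_of_mem (Set.mem_Iio.2 ha), Real.cos_abs]
    · rw [Set.indicator_of_notMem (by simpa using ha)]
      have : {b | (a, b) ∈ S} = ∅ := by
        ext b
        simp only [Set.mem_ofPred_eq, Set.mem_empty_iff_false, iff_false]
        exact fun hab => ha (lt_of_le_of_lt (le_add_of_nonneg_right (abs_nonneg b)) (hb _ hab))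
      simp [this]
  simp_rw [h1, h2]
  -- Evenness in `a` gives a factor 2; together with the 2 in the section length this makes 4.
  rw [integral_comp_abs, setIntegral_indicator measurableSet_Iio, Set.Ioi_inter_Iio,
    integral_const_mul, setIntegral_comp_cos, ← setIntegral_indicator hA, ← mul_assoc]
  congr 1
  · norm_num
  · refine integral_congr_ae (.of_forall fun t => ?_)
    by_cases ht : t ∈ A <;> simp [ht]

/-- Passing from the diamond to the coordinates `(u / √2, v / √2)`. -/
theorem volume_real_scale (S : Set (ℝ × ℝ)) :
    volume.real {p : ℝ × ℝ | (p.1 / √2, p.2 / √2) ∈ S} = 2 * volume.real S := by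
  have hs : (√2)⁻¹ ≠ 0 := by positivity
  have h := Measure.addHaar_preimage_smul (volume : Measure (ℝ × ℝ)) hs S
  have hset : {p : ℝ × ℝ | (p.1 / √2, p.2 / √2) ∈ S} = ((√2)⁻¹ • ·) ⁻¹' S := by
    ext p
    rw [Set.mem_preimage, Set.mem_ofPred_eq]
    have : (√2)⁻¹ • p = (p.1 / √2, p.2 / √2) := by
      ext <;> simp [div_eq_inv_mul]
    rw [this]
  rw [hset, Measure.real, h, ENNReal.toReal_mul, ENNReal.toReal_ofReal (abs_nonneg _), Measure.real]
  congr 1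
  simp [Module.finrank_prod]

theorem mem_triDiamond_iff (p : ℝ × ℝ) :
    p ∈ triDiamond ↔ |p.1 / √2| + |p.2 / √2| < Real.pi := by
  have hs : 0 < √2 := by positivity
  rw [abs_div, abs_div, abs_of_pos hs, ← add_div, div_lt_iff₀ hs]
  rfl

theorem triF_eq (p : ℝ × ℝ) :
    triF p = 2 * Real.cos (p.1 / √2) * Real.cos (p.2 / √2) + 2 * Real.cos (p.1 / √2) ^ 2 - 1 := rfl

/-- Cosine decreases on `[0, π]` and `|b| < π - |a|`. This fixes the sign of `cos a + cos b` on the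
diamond. -/
theorem neg_cos_lt_cos {a b : ℝ} (h : |a| + |b| < Real.pi) : -Real.cos a < Real.cos b := by
  rw [← Real.cos_abs a, ← Real.cos_abs b, ← Real.cos_pi_sub]
  have := abs_nonneg a
  have := abs_nonneg b
  exact Real.strictAntiOn_cos ⟨by linarith, by linarith⟩ ⟨by linarith, by linarith⟩ (by linarith)

theorem arccos_neg_cos {a : ℝ} (h : |a| < Real.pi) : Real.arccos (-Real.cos a) = Real.pi - |a| := by
  rw [Real.arccos_neg, ← Real.cos_abs, Real.arccos_cos (abs_nonneg a) h.le]

theorem le_cos_iff {g b : ℝ} (hg : -1 ≤ g) (hg' : g ≤ 1) (hb : |b| ≤ Real.pi) :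
    g ≤ Real.cos b ↔ |b| ≤ Real.arccos g := by
  conv_lhs => rw [← Real.cos_abs b, ← Real.cos_arccos hg hg']
  exact Real.strictAntiOn_cos.le_iff_ge ⟨Real.arccos_nonneg _, Real.arccos_le_pi _⟩
    ⟨abs_nonneg b, hb⟩

theorem lt_cos_iff {g b : ℝ} (hg : -1 ≤ g) (hg' : g ≤ 1) (hb : |b| ≤ Real.pi) :
    g < Real.cos b ↔ |b| < Real.arccos g := by
  conv_lhs => rw [← Real.cos_abs b, ← Real.cos_arccos hg hg']
  exact Real.strictAntiOn_cos.lt_iff_gt ⟨Real.arccos_nonneg _, Real.arccos_le_pi _⟩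
    ⟨abs_nonneg b, hb⟩

/-- Sections of the superlevel set for a positive level. -/
theorem volume_section_ge {c t₀ a : ℝ} (hc : 0 < c) (ht₀ : 0 < t₀) (hroot : 2 * t₀ ^ 2 + 2 * t₀ = c)
    (ha : |a| < Real.pi) :
    volume.real {b : ℝ | |a| + |b| < Real.pi ∧
        c ≤ 2 * Real.cos a * Real.cos b + 2 * Real.cos a ^ 2}
      = 2 * (Set.Ioi t₀).indicator (fun t => Real.arccos (c / (2 * t) - t)) (Real.cos a) := by
  set t := Real.cos a with ht
  rcases le_or_gt t 0 with h0 | h0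
  · rw [Set.indicator_of_notMem (by simp; linarith)]
    have : {b : ℝ | |a| + |b| < Real.pi ∧ c ≤ 2 * t * Real.cos b + 2 * t ^ 2} = ∅ := by
      ext b
      simp only [Set.mem_ofPred_eq, Set.mem_empty_iff_false, iff_false]
      rintro ⟨hb, h⟩
      nlinarith [neg_cos_lt_cos hb]
    simp [this]
  have hiff : ∀ b : ℝ, c ≤ 2 * t * Real.cos b + 2 * t ^ 2 ↔ c / (2 * t) - t ≤ Real.cos b := by
    intro b
    rw [sub_le_iff_le_add, div_le_iff₀ (by positivity)]
    ring_nf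
  simp_rw [hiff]
  -- For `0 < t ≤ t₀` the bound on `cos b` is at least 1, so only `b = 0` can survive; beyond `t₀`
  -- the section is an interval.
  rcases le_or_gt t t₀ with h1 | h1
  · rw [Set.indicator_of_notMem (by simpa using h1), mul_zero, Measure.real,
      measure_mono_null (t := {0}), ENNReal.toReal_zero]
    · rintro b ⟨hb, h⟩
      have hg : 1 ≤ c / (2 * t) - t := by
        rw [le_sub_iff_add_le, le_div_iff₀ (by positivity)]
        nlinarith
      have hcos : Real.cos b = 1 := le_antisymm (Real.cos_le_one b) (hg.trans h)
      have hb' : |b| < Real.pi := lt_of_le_of_lt (le_add_of_nonneg_left (abs_nonneg a)) hb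
      obtain ⟨h2, h3⟩ := abs_lt.1 hb'
      exact (Real.cos_eq_one_iff_of_lt_of_lt (by linarith) (by linarith)).1 hcos
    · simp
  · rw [Set.indicator_of_mem (Set.mem_Ioi.2 h1)]
    set g := c / (2 * t) - t with hg
    have hg1 : g ≤ 1 := by
      rw [hg, sub_le_iff_le_add, div_le_iff₀ (by positivity)]
      nlinarith
    have hg2 : -t < g := by
      have : 0 < c / (2 * t) := by positivity
      linarith
    have hgm : -1 ≤ g := by linarith [Real.cos_le_one a]
    -- Positivity of `c` gives `g > -cos a`, so the closed interval `|b| ≤ arccos g` already lies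
    -- inside the diamond.
    have harc : Real.arccos g < Real.pi - |a| := by
      rw [← arccos_neg_cos ha]
      exact Real.strictAntiOn_arccos ⟨by linarith [Real.cos_le_one a], by linarith⟩ ⟨hgm, hg1⟩ hg2
    have hset : {b : ℝ | |a| + |b| < Real.pi ∧ g ≤ Real.cos b}
        = Set.Icc (-Real.arccos g) (Real.arccos g) := by
      ext b
      rw [Set.mem_ofPred_eq, Set.mem_Icc, ← abs_le]
      constructor
      · rintro ⟨hb, h⟩
        exact (le_cos_iff hgm hg1 (by linarith [abs_nonneg a])).1 h
      · intro h
        exact ⟨by linarith, (le_cos_iff hgm hg1 (by linarith [abs_nonneg a])).2 h⟩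
    rw [hset, Real.volume_real_Icc_of_le (by linarith [Real.arccos_nonneg g])]
    ring

/-- Sections of the sublevel set for a nonpositive level. -/
theorem volume_section_lt {c t₁ t₂ a : ℝ} (hc : c ≤ 0)
    (hroot : ∀ t, 2 * t ^ 2 + 2 * t < c ↔ t₁ < t ∧ t < t₂) (ha : |a| < Real.pi) :
    volume.real {b : ℝ | |a| + |b| < Real.pi ∧
        2 * Real.cos a * Real.cos b + 2 * Real.cos a ^ 2 < c}
      = 2 * (Set.Ioo t₁ t₂).indicator (fun t => Real.arccos (c / (2 * t) - t)) (Real.cos a) := by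
  set t := Real.cos a with ht
  rcases le_or_gt 0 t with h0 | h0
  · rw [Set.indicator_of_notMem (by
      intro h
      nlinarith [(hroot t).2 h])]
    have : {b : ℝ | |a| + |b| < Real.pi ∧ 2 * t * Real.cos b + 2 * t ^ 2 < c} = ∅ := by
      ext b
      simp only [Set.mem_ofPred_eq, Set.mem_empty_iff_false, iff_false]
      rintro ⟨hb, h⟩
      nlinarith [neg_cos_lt_cos hb]
    simp [this]
  have hiff : ∀ b : ℝ, 2 * t * Real.cos b + 2 * t ^ 2 < c ↔ c / (2 * t) - t < Real.cos b := by
    intro b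
    rw [sub_lt_iff_lt_add, div_lt_iff_of_neg (by linarith)]
    ring_nf
  simp_rw [hiff]
  set g := c / (2 * t) - t with hg
  by_cases h1 : t ∈ Set.Ioo t₁ t₂
  · rw [Set.indicator_of_mem h1]
    have hg1 : g ≤ 1 := by
      rw [hg, sub_le_iff_le_add, div_le_iff_of_neg (by linarith)]
      nlinarith [(hroot t).2 h1]
    -- Here `c ≤ 0` and `t < 0` make `c / (2t)` nonnegative. Equality is harmless, since the section
    -- is an open interval.
    have hg2 : -t ≤ g := by
      have : 0 ≤ c / (2 * t) := div_nonneg_of_nonpos hc (by linarith)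
      linarith
    have hgm : -1 ≤ g := by linarith
    have harc : Real.arccos g ≤ Real.pi - |a| := by
      rw [← arccos_neg_cos ha]
      exact Real.antitone_arccos hg2
    have hset : {b : ℝ | |a| + |b| < Real.pi ∧ g < Real.cos b}
        = Set.Ioo (-Real.arccos g) (Real.arccos g) := by
      ext b
      rw [Set.mem_ofPred_eq, Set.mem_Ioo, ← abs_lt]
      constructor
      · rintro ⟨hb, h⟩
        exact (lt_cos_iff hgm hg1 (by linarith [abs_nonneg a])).1 h
      · intro h
        exact ⟨by linarith, (lt_cos_iff hgm hg1 (by linarith [abs_nonneg a])).2 h⟩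
    rw [hset, Real.volume_real_Ioo_of_le (by linarith [Real.arccos_nonneg g])]
    ring
  · rw [Set.indicator_of_notMem h1]
    have hg1 : 1 ≤ g := by
      have h2 : c ≤ 2 * t ^ 2 + 2 * t := not_lt.1 fun h => h1 ((hroot t).1 h)
      rw [hg, le_sub_iff_add_le, le_div_iff_of_neg (by linarith)]
      nlinarith
    have : {b : ℝ | |a| + |b| < Real.pi ∧ g < Real.cos b} = ∅ := by
      ext b
      simp only [Set.mem_ofPred_eq, Set.mem_empty_iff_false, iff_false]
      rintro ⟨-, h⟩
      linarith [Real.cos_le_one b]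
    simp [this]

/-- `Real.arccos` stays in `[0, π]` for every real argument, so neither `t = 0` nor values outside
`[-1, 1]` matter. -/
theorem integrableOn_triIntegrand (E : ℝ) : IntegrableOn (triIntegrand E) (Set.Ioo (-1) 1) :=
  integrableOn_div_sqrt_one_sub_sq (h := fun t => Real.arccos ((4 - 3 * E) / (2 * t) - t))
    (by fun_prop) (C := Real.pi) fun t => by
      rw [Real.norm_eq_abs, abs_of_nonneg (Real.arccos_nonneg _)]
      exact Real.arccos_le_pi _

theorem intervalIntegrable_triIntegrand (E : ℝ) {s t : ℝ} (hst : s ≤ t) (hs : -1 ≤ s) (ht : t ≤ 1) :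
    IntervalIntegrable (triIntegrand E) volume s t := by
  rw [intervalIntegrable_iff_integrableOn_Ioo_of_le hst]
  exact (integrableOn_triIntegrand E).mono_set (Set.Ioo_subset_Ioo hs ht)

/-- The endpoint `t₀` is where `c / (2t) - t = 1` for `c = 4 - 3E`. The factor 8 is 2 from rescaling
by `√2` in each variable times 4 from the sections. -/
theorem volume_real_triF_ge {E t₀ : ℝ} (hE : E < 4 / 3) (ht₀ : 0 < t₀) (ht₁ : t₀ ≤ 1)
    (hroot : 2 * t₀ ^ 2 + 2 * t₀ = 4 - 3 * E) :
    volume.real {p : ℝ × ℝ | p ∈ triDiamond ∧ triF p ≥ 3 - 3 * E}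
      = 8 * ∫ t in t₀..1, triIntegrand E t := by
  let S : Set (ℝ × ℝ) := {p | |p.1| + |p.2| < Real.pi ∧
    4 - 3 * E ≤ 2 * Real.cos p.1 * Real.cos p.2 + 2 * Real.cos p.1 ^ 2}
  have hset : {p : ℝ × ℝ | p ∈ triDiamond ∧ triF p ≥ 3 - 3 * E}
      = {p : ℝ × ℝ | (p.1 / √2, p.2 / √2) ∈ S} := by
    ext p
    simp only [S, Set.mem_ofPred_eq, mem_triDiamond_iff, triF_eq]
    refine and_congr_right fun _ => ⟨fun h => ?_, fun h => ?_⟩ <;> linarith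
  have hS : MeasurableSet S := by
    have h1 : MeasurableSet {p : ℝ × ℝ | |p.1| + |p.2| < Real.pi} :=
      measurableSet_lt (by fun_prop) measurable_const
    have h2 : MeasurableSet {p : ℝ × ℝ | 4 - 3 * E ≤ 2 * Real.cos p.1 * Real.cos p.2 + 2 * Real.cos p.1 ^ 2} :=
      measurableSet_le measurable_const (by fun_prop)
    exact h1.inter h2
  rw [hset, volume_real_scale, volume_real_of_sections hS (fun p hp => hp.1) measurableSet_Ioi
    (fun a ha => volume_section_ge (by linarith) ht₀ hroot ha), Set.Ioo_inter_Ioi,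
    max_eq_right (by linarith), intervalIntegral.integral_of_le ht₁, integral_Ioc_eq_integral_Ioo,
    ← mul_assoc]
  norm_num
  rfl

theorem volume_real_triF_lt {E t₁ t₂ : ℝ} (hE : 4 / 3 ≤ E) (h12 : t₁ ≤ t₂) (ht₁ : -1 ≤ t₁)
    (ht₂ : t₂ ≤ 1) (hroot : ∀ t, 2 * t ^ 2 + 2 * t < 4 - 3 * E ↔ t₁ < t ∧ t < t₂) :
    volume.real {p : ℝ × ℝ | p ∈ triDiamond ∧ triF p < 3 - 3 * E}
      = 8 * ∫ t in t₁..t₂, triIntegrand E t := by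
  let S : Set (ℝ × ℝ) := {p | |p.1| + |p.2| < Real.pi ∧
    2 * Real.cos p.1 * Real.cos p.2 + 2 * Real.cos p.1 ^ 2 < 4 - 3 * E}
  have hset : {p : ℝ × ℝ | p ∈ triDiamond ∧ triF p < 3 - 3 * E}
      = {p : ℝ × ℝ | (p.1 / √2, p.2 / √2) ∈ S} := by
    ext p
    simp only [S, Set.mem_ofPred_eq, mem_triDiamond_iff, triF_eq]
    refine and_congr_right fun _ => ⟨fun h => ?_, fun h => ?_⟩ <;> linarith
  have hS : MeasurableSet S := by
    have h1 : MeasurableSet {p : ℝ × ℝ | |p.1| + |p.2| < Real.pi} :=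
      measurableSet_lt (by fun_prop) measurable_const
    have h2 : MeasurableSet {p : ℝ × ℝ | 2 * Real.cos p.1 * Real.cos p.2 + 2 * Real.cos p.1 ^ 2 < 4 - 3 * E} :=
      measurableSet_lt (by fun_prop) measurable_const
    exact h1.inter h2
  rw [hset, volume_real_scale, volume_real_of_sections hS (fun p hp => hp.1) measurableSet_Ioo
    (fun a ha => volume_section_lt (by linarith) hroot ha), Set.Ioo_inter_Ioo,
    max_eq_right ht₁, min_eq_right ht₂, intervalIntegral.integral_of_le h12,
    integral_Ioc_eq_integral_Ioo, ← mul_assoc]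
  norm_num
  rfl

end Integrals

/-! ### Assembly of the formula for the IDS -/

theorem triIDS_eq_volume {Q : Finset (ℤ × ℤ)} (hQ : IsVertexFundamentalDomain triTranslate Q)
    (E : ℝ) : triIDS Q E = 1 / (2 * Real.pi) ^ 2 *
      MeasureTheory.volume.real {p : ℝ × ℝ | p ∈ triDiamond ∧ triF p ≥ 3 - 3 * E} := by
  rw [triIDS_eq_torusMeasure hQ]
  refine (torusMeasure_real_triSymbol_preimage (measurableSet_Iic (a := E))).trans ?_
  congr 3
  ext p
  refine and_congr_right fun _ => ?_
  rw [Set.mem_Iic]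
  constructor <;> intro h <;> linarith

/-- The complement is taken on the torus, where the total mass is 1, so the area of the diamond is
not needed. -/
theorem triIDS_eq_one_sub_volume {Q : Finset (ℤ × ℤ)}
    (hQ : IsVertexFundamentalDomain triTranslate Q) (E : ℝ) :
    triIDS Q E = 1 - 1 / (2 * Real.pi) ^ 2 *
      MeasureTheory.volume.real {p : ℝ × ℝ | p ∈ triDiamond ∧ triF p < 3 - 3 * E} := by
  have h := torusMeasure_real_triSymbol_preimage (measurableSet_Ioi (a := E))
  have hset : {p : ℝ × ℝ | p ∈ triDiamond ∧ triF p < 3 - 3 * E}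
      = {p : ℝ × ℝ | p ∈ triDiamond ∧ 1 - triF p / 3 ∈ Set.Ioi E} := by
    ext p
    refine and_congr_right fun _ => ?_
    rw [Set.mem_Ioi]
    constructor <;> intro h <;> linarith
  have hcompl : {x | triSymbol x ∈ Set.Ioi E} = {x | triSymbol x ≤ E}ᶜ := by
    ext x
    simp
  rw [triIDS_eq_torusMeasure hQ, hset, ← h, hcompl, MeasureTheory.probReal_compl_eq_one_sub
    (measurableSet_le triSymbol.continuous.measurable measurable_const)]
  ring

theorem triF_le (p : ℝ × ℝ) : triF p ≤ 3 := by
  have h1 := Real.neg_one_le_cos (p.1 / √2)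
  have h2 := Real.cos_le_one (p.1 / √2)
  have h3 := Real.neg_one_le_cos (p.2 / √2)
  have h4 := Real.cos_le_one (p.2 / √2)
  rw [triF_eq]
  nlinarith [mul_nonneg (sub_nonneg.2 h2) (sub_nonneg.2 h4),
    sq_nonneg (Real.cos (p.1 / √2) - Real.cos (p.2 / √2))]

/-- With `x = cos (u / √2)` and `y = cos (v / √2)`, `triF + 3/2 = (2x + y)² / 2 + (1 - y²) / 2`. -/
theorem neg_le_triF (p : ℝ × ℝ) : -(3 / 2) ≤ triF p := by
  have h3 := Real.neg_one_le_cos (p.2 / √2)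
  have h4 := Real.cos_le_one (p.2 / √2)
  rw [triF_eq]
  nlinarith [sq_nonneg (2 * Real.cos (p.1 / √2) + Real.cos (p.2 / √2))]

theorem mainTheorem5 (Q : Finset (ℤ × ℤ)) (hQ : IsVertexFundamentalDomain triTranslate Q) :
    (∀ E : ℝ, triIDS Q E
      = 1 / (2 * Real.pi) ^ 2 *
        MeasureTheory.volume.real {p : ℝ × ℝ | p ∈ triDiamond ∧ triF p ≥ 3 - 3 * E}) ∧
    (∀ E : ℝ, E < 0 → triIDS Q E = 0) ∧
    (∀ E : ℝ, 0 ≤ E → E < 4 / 3 →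
      IntervalIntegrable (triIntegrand E) MeasureTheory.volume
        (-1 / 2 + 1 / 2 * Real.sqrt (9 - 6 * E)) 1 ∧
      triIDS Q E
        = 2 / Real.pi ^ 2 *
          ∫ t in (-1 / 2 + 1 / 2 * Real.sqrt (9 - 6 * E))..1, triIntegrand E t) ∧
    (∀ E : ℝ, 4 / 3 ≤ E → E < 3 / 2 →
      IntervalIntegrable (triIntegrand E) MeasureTheory.volume
        (-1 / 2 - 1 / 2 * Real.sqrt (9 - 6 * E)) (-1 / 2 + 1 / 2 * Real.sqrt (9 - 6 * E)) ∧
      triIDS Q E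
        = 1 - 2 / Real.pi ^ 2 *
          ∫ t in (-1 / 2 - 1 / 2 * Real.sqrt (9 - 6 * E))..(-1 / 2 + 1 / 2 * Real.sqrt (9 - 6 * E)),
            triIntegrand E t) ∧
    (∀ E : ℝ, 3 / 2 ≤ E → triIDS Q E = 1) ∧
    Continuous (triIDS Q) ∧
    (∀ z : ℂ, ¬ Module.End.HasEigenvalue (triLaplacian : Module.End ℂ (EllTwo (ℤ × ℤ))) z) := by

  have hpi := Real.pi_ne_zero
  refine ⟨triIDS_eq_volume hQ, fun E hE => ?_, fun E h0 h1 => ?_, fun E h0 h1 => ?_,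
    fun E hE => ?_, ?_, ?_⟩
  · have : {p : ℝ × ℝ | p ∈ triDiamond ∧ triF p ≥ 3 - 3 * E} = ∅ := by
      ext p
      simp only [Set.mem_ofPred_eq, Set.mem_empty_iff_false, iff_false]
      rintro ⟨-, h⟩
      linarith [triF_le p]
    rw [triIDS_eq_volume hQ, this]
    simp
  · set r := √(9 - 6 * E) with hr
    have hr2 : r ^ 2 = 9 - 6 * E := Real.sq_sqrt (by linarith)
    -- `E < 4/3` makes the lower endpoint positive; `E ≥ 0` gives `r ≤ 3`, which keeps it at most 1.
    have hr1 : 1 < r := by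
      rw [hr]
      exact Real.lt_sqrt_of_sq_lt (by linarith)
    have hr3 : r ≤ 3 := by nlinarith
    refine ⟨intervalIntegrable_triIntegrand E (by linarith) (by linarith) le_rfl, ?_⟩
    rw [triIDS_eq_volume hQ, volume_real_triF_ge h1 (t₀ := -1 / 2 + 1 / 2 * r) (by linarith)
      (by linarith) (by linear_combination hr2 / 2)]
    field_simp
    ring
  · set r := √(9 - 6 * E) with hr
    have hr2 : r ^ 2 = 9 - 6 * E := Real.sq_sqrt (by linarith)
    have hr0 : 0 ≤ r := Real.sqrt_nonneg _
    -- This is `E ≥ 4/3`; it places both roots in `[-1, 0]`.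
    have hr1 : r ≤ 1 := by nlinarith
    have hroot : ∀ t, 2 * t ^ 2 + 2 * t < 4 - 3 * E ↔ -1 / 2 - 1 / 2 * r < t ∧ t < -1 / 2 + 1 / 2 * r := by
      intro t
      -- Completing the square: `2 (4 - 3E) + 1 = 9 - 6E`.
      have h2 : 2 * t ^ 2 + 2 * t < 4 - 3 * E ↔ (2 * t + 1) ^ 2 < r ^ 2 := by
        rw [hr2]
        constructor <;> intro h <;> nlinarith
      rw [h2, sq_lt_sq, abs_of_nonneg hr0, abs_lt]
      constructor <;> rintro ⟨h3, h4⟩ <;> constructor <;> linarith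
    refine ⟨intervalIntegrable_triIntegrand E (by linarith) (by linarith) (by linarith), ?_⟩
    rw [triIDS_eq_one_sub_volume hQ, volume_real_triF_lt h0 (by linarith) (by linarith)
      (by linarith) hroot]
    field_simp
    ring
  · have : {p : ℝ × ℝ | p ∈ triDiamond ∧ triF p < 3 - 3 * E} = ∅ := by
      ext p
      simp only [Set.mem_ofPred_eq, Set.mem_empty_iff_false, iff_false]
      rintro ⟨-, h⟩
      linarith [neg_le_triF p]
    rw [triIDS_eq_one_sub_volume hQ, this]
    simp
  · have h := continuous_measureReal_le triSymbol.continuous.measurable torusMeasure_triSymbol_eq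
    exact h.congr fun E => (triIDS_eq_torusMeasure hQ E).symm
  · rw [triLaplacian_eq_mulRep]
    exact not_hasEigenvalue_mulRep torusMeasure torusBasis.repr triSymbol torusMeasure_triSymbol_eq
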